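/- For $n\ge 0$ let $s_i=(i\;\,i+1)$, $1\le i\le n-1$, be the adjacent transpositions in the symmetric group $S_n$. The length $\ell(w)$ of $w\in S_n$ is the minimal $\ell$ such that $w=s_{i_1}\cdots s_{i_\ell}$ for some $i_1,\dots,i_\ell$, and such an expression of minimal length is called a reduced word of $w$. Let $J(w)=\{s_i : \ell(s_iw)<\ell(w)\}$ be the left descent set of $w$. The Dynkin diagram is the graph on $\{s_1,\dots,s_{n-1}\}$ in which $s_i$ and $s_j$ are adjacent if and only if $|i-j|=1$. For $C\subseteq\{s_1,\dots,s_{n-1}\}$ let $w_0(C)$ be the element of maximum length in the subgroup of $S_n$ generated by $C$. A permutation $w\in S_n$ is called spherical if it has a reduced word $s_{i_1}\cdots s_{i_{\ell(w)}}$ such that (S.1) $|\{t : s_{i_t}=s_j\}|\le 1$ for every $s_j\notin J(w)$, and (S.2) $|\{t : s_{i_t}\in C\}|\le \ell(w_0(C))+|C|$ for every connected component $C$ of the subgraph of the Dynkin diagram induced on $J(w)$. Corollary 1.5 (density of spherical permutations). The proportion of spherical permutations in $S_n$ tends to zero: $$\lim_{n\to\infty}\frac{|\{w\in S_n : w\text{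 is spherical}\}|}{n!}=0.$$ -/

import Mathlib

namespace SphericalPerm

/-- The simple generator `s_i`, the adjacent transposition of `i` and `i + 1` in `S_n`.
Everything is 0-based: `S_n` acts on `{0, …, n - 1}`, and the `n - 1` simple generators are indexed
by `{0, …, n - 2}` (there are none when `n ≤ 1`). -/
def simpleGen {n : ℕ} (i : Fin (n - 1)) : Equiv.Perm (Fin n) :=
  Equiv.swap ⟨i, by omega⟩ ⟨i + 1, by omega⟩

/-- The product `s_{i_1} ⋯ s_{i_k}` of a word in the simple generators, a word being recorded
as the list of its indices. -/
def wordProd {n : ℕ} (l : List (Fin (n - 1))) : Equiv.Perm (Fin n) :=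
  (l.map simpleGen).prod

/-- The simple generators generate `S_n`; in particular the minimum defining `length` is taken over
a nonempty set. -/
theorem exists_wordProd_eq {n : ℕ} (w : Equiv.Perm (Fin n)) :
    ∃ l : List (Fin (n - 1)), wordProd l = w := by
  cases n with
  | zero => exact ⟨[], Subsingleton.elim _ _⟩
  | succ m =>
    have h : w ∈ Submonoid.closure
        (Set.range fun i : Fin m => Equiv.swap i.castSucc i.succ) := by
      rw [Equiv.Perm.mclosure_swap_castSucc_succ]
      trivial
    induction h using Submonoid.closure_induction with
    | mem x hx =>
      obtain ⟨i, rfl⟩ := hx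
      exact ⟨[i], by simp only [wordProd, List.map_cons, List.map_nil, List.prod_singleton]; rfl⟩
    | one => exact ⟨[], rfl⟩
    | mul x y _ _ hx hy =>
      obtain ⟨a, rfl⟩ := hx
      obtain ⟨b, rfl⟩ := hy
      exact ⟨a ++ b, by simp [wordProd]⟩

/-- The length `ℓ(w)`: the minimum length of a word in the simple generators with product `w`. -/
noncomputable def length {n : ℕ} (w : Equiv.Perm (Fin n)) : ℕ :=
  sInf {k | ∃ l : List (Fin (n - 1)), wordProd l = w ∧ l.length = k}

/-- `l` is a reduced word for `w`. -/
def IsReducedWord {n : ℕ} (l : List (Fin (n - 1))) (w : Equiv.Perm (Fin n)) : Prop :=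
  wordProd l = w ∧ l.length = length w

/-- The left descent set `J(w) = {s_i | ℓ(s_i w) < ℓ(w)}`, as a set of indices. -/
def leftDescents {n : ℕ} (w : Equiv.Perm (Fin n)) : Set (Fin (n - 1)) :=
  {i | length (simpleGen i * w) < length w}

/-- The subgroup of `S_n` generated by the `s_i` with `i ∈ C`. -/
def parabolic {n : ℕ} (C : Set (Fin (n - 1))) : Subgroup (Equiv.Perm (Fin n)) :=
  Subgroup.closure (simpleGen '' C)

theorem exists_longest {n : ℕ} (C : Set (Fin (n - 1))) :
    ∃ v ∈ parabolic C, ∀ u ∈ parabolic C, length u ≤ length v :=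
  Set.exists_max_image (parabolic C : Set (Equiv.Perm (Fin n))) length (Set.toFinite _)
    ⟨1, (parabolic C).one_mem⟩

/-- `w₀(C)`: the element of maximum length in the subgroup generated by the `s_i` with `i ∈ C`. -/
noncomputable def longest {n : ℕ} (C : Set (Fin (n - 1))) : Equiv.Perm (Fin n) :=
  (exists_longest C).choose

/-- The Dynkin diagram of `S_n`: the path on the `n - 1` simple generators, `s_i` and `s_j` being
adjacent exactly when `|i - j| = 1`. -/
def dynkin (n : ℕ) : SimpleGraph (Fin (n - 1)) :=
  SimpleGraph.pathGraph (n - 1)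

/-- `C` is (the vertex set of) a connected component of the induced subgraph of the Dynkin diagram
on `J`. -/
def IsComponent {n : ℕ} (J C : Set (Fin (n - 1))) : Prop :=
  ∃ c : ((dynkin n).induce J).ConnectedComponent, C = Subtype.val '' c.supp

open Classical in
/-- A permutation `w ∈ S_n` is spherical if it has a reduced word in which every simple generator
outside `J(w)` occurs at most once and, for every connected component `C` of the Dynkin
diagram restricted to `J(w)`, at most `ℓ(w₀(C)) + |C|` letters belong to `C`. -/
def IsSpherical {n : ℕ} (w : Equiv.Perm (Fin n)) : Prop :=
  ∃ l : List (Fin (n - 1)), IsReducedWord l w ∧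
    (∀ j, j ∉ leftDescents w → l.count j ≤ 1) ∧
    (∀ C, IsComponent (leftDescents w) C →
      l.countP (fun i => decide (i ∈ C)) ≤ length (longest C) + C.ncard)

end SphericalPerm

namespace SphericalPerm

open Equiv

/-! Condition (S.1) alone forces density zero. Fix `k` and look at the generators indexed by `1, …,
k`. If one of them, `j`, is not a left descent, it occurs at most once in the word, so at most one
point crosses the cut after `j` (`card_crossing_le_count`). Hence `0` or `1` stays in `{0, …, k}`,
which has probability at most `(k + 1)^2 / n`. If all are left descents, `w⁻¹` is smallest at `k +
1` among `1, …, k + 1`, which has probability at most `1 / (k + 1)`. Let `n → ∞`, then `k → ∞`. -/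

/-- Strong exchange: a transposition that undoes an inversion deletes a letter. -/
theorem exists_shorter_word {n : ℕ} (l : List (Fin (n - 1))) :
    ∀ a b : Fin n, a < b → (wordProd l)⁻¹ b < (wordProd l)⁻¹ a →
      ∃ l' : List (Fin (n - 1)), wordProd l' = swap a b * wordProd l ∧ l'.length < l.length := by
  induction l with
  | nil =>
    intro a b hab h
    simp only [wordProd, List.map_nil, List.prod_nil, inv_one, Perm.one_apply] at h
    exact absurd h hab.not_gt
  | cons i l ih =>
    intro a b hab h
    have hw : wordProd (i :: l) = simpleGen i * wordProd l := by simp [wordProd]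
    have hinv : (simpleGen i)⁻¹ = simpleGen i := by simp [simpleGen]
    have hsq : simpleGen i * simpleGen i = 1 := by simp [simpleGen]
    rw [hw, mul_inv_rev, hinv, Perm.mul_apply, Perm.mul_apply] at h
    rcases lt_trichotomy (simpleGen i a) (simpleGen i b) with hlt | heq | hgt
    -- The first letter keeps the order of `a` and `b`: conjugate the transposition past it.
    · obtain ⟨l', h1, h2⟩ := ih _ _ hlt h
      refine ⟨i :: l', ?_, by simpa using h2⟩
      have hc : wordProd (i :: l') = simpleGen i * wordProd l' := by simp [wordProd]
      rw [hc, hw, h1, ← mul_assoc, ← mul_assoc, swap_apply_apply, hinv]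
      congr 1
      rw [← mul_assoc, ← mul_assoc, hsq, one_mul]
    · exact absurd ((simpleGen i).injective heq) hab.ne
    -- An adjacent transposition reverses only its own pair, so the first letter is the one to
    -- delete.
    · have hs : swap a b = simpleGen i := by
        have : (a : ℕ) = i ∧ (b : ℕ) = i + 1 := by
          simp only [simpleGen, swap_apply_def, Fin.ext_iff, Fin.lt_def] at hgt hab
          split_ifs at hgt <;> simp_all <;> omega
        unfold simpleGen
        congr 1 <;> ext <;> simp [this]
      refine ⟨l, ?_, by simp⟩
      rw [hw, hs, ← mul_assoc, hsq, one_mul]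

theorem length_le_of_word {n : ℕ} (l : List (Fin (n - 1))) :
    length (wordProd l) ≤ l.length :=
  Nat.sInf_le ⟨l, rfl, rfl⟩

theorem exists_reducedWord {n : ℕ} (w : Perm (Fin n)) :
    ∃ l : List (Fin (n - 1)), IsReducedWord l w := by
  obtain ⟨l, hl⟩ := exists_wordProd_eq w
  exact Nat.sInf_mem (s := {k | ∃ l : List (Fin (n - 1)), wordProd l = w ∧ l.length = k})
    ⟨_, l, hl, rfl⟩

theorem length_simpleGen_mul_lt {n : ℕ} (w : Perm (Fin n)) (j : Fin (n - 1))
    (h : w⁻¹ ⟨j + 1, by omega⟩ < w⁻¹ ⟨j, by omega⟩) :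
    length (simpleGen j * w) < length w := by
  obtain ⟨l, rfl, hl⟩ := exists_reducedWord w
  obtain ⟨l', h1, h2⟩ := exists_shorter_word l _ _ (by simp [Fin.lt_def]) h
  calc length (simpleGen j * wordProd l) = length (wordProd l') := by rw [h1]; rfl
    _ ≤ l'.length := length_le_of_word l'
    _ < _ := hl ▸ h2

/-- Otherwise `simpleGen j * w` has the inversion, and multiplying it by `simpleGen j` shows that
`w` is the shorter one. -/
theorem inv_lt_inv_of_mem_leftDescents {n : ℕ} {w : Perm (Fin n)} {j : Fin (n - 1)}
    (h : j ∈ leftDescents w) : w⁻¹ ⟨j + 1, by omega⟩ < w⁻¹ ⟨j, by omega⟩ := by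
  by_contra hn
  have hlt : w⁻¹ ⟨j, by omega⟩ < w⁻¹ ⟨j + 1, by omega⟩ :=
    lt_of_le_of_ne (not_lt.1 hn) fun he => by simpa using w⁻¹.injective he
  have := length_simpleGen_mul_lt (simpleGen j * w) j (by simpa [simpleGen] using hlt)
  rw [← mul_assoc, show simpleGen j * simpleGen j = 1 by simp [simpleGen], one_mul] at this
  exact absurd h this.not_gt

/-- The number of points that `w` carries across the cut after `j` is at most the number of
occurrences of `s_j` in a word for `w`. -/
theorem card_crossing_le_count {n : ℕ} (j : Fin (n - 1)) (l : List (Fin (n - 1))) :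
    (Finset.univ.filter fun x : Fin n => (x : ℕ) ≤ j ∧ (j : ℕ) < wordProd l x).card
      ≤ l.count j := by
  induction l with
  | nil =>
    simp only [wordProd, List.map_nil, List.prod_nil, Perm.one_apply, List.count_nil,
      Nat.le_zero, Finset.card_eq_zero, Finset.filter_eq_empty_iff]
    omega
  | cons i l ih =>
    have hw : ∀ x, wordProd (i :: l) x = simpleGen i (wordProd l x) := by simp [wordProd]
    by_cases hij : i = j
    · subst hij
      rw [List.count_cons_self]
      -- The letter `s_i` carries only one point up across the cut, the one sitting at `i`.
      refine le_trans (Finset.card_le_card (t := insert ((wordProd l)⁻¹ ⟨i, by omega⟩)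
        (Finset.univ.filter fun x : Fin n => (x : ℕ) ≤ i ∧ (i : ℕ) < wordProd l x)) ?_)
        ((Finset.card_insert_le _ _).trans (by omega))
      intro x hx
      simp only [Finset.mem_filter, Finset.mem_univ, true_and, Finset.mem_insert, hw] at hx ⊢
      by_cases hx' : wordProd l x = ⟨i, by omega⟩
      · left; rw [← hx']; simp
      · refine Or.inr ⟨hx.1, ?_⟩
        have := hx.2
        simp only [simpleGen, swap_apply_def, hx', if_false] at this
        split_ifs at this with h2
        · simp at this
        · exact this
    · rw [List.count_cons_of_ne hij]
      refine le_trans (Finset.card_le_card ?_) ih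
      intro x hx
      simp only [Finset.mem_filter, Finset.mem_univ, true_and, hw] at hx ⊢
      refine ⟨hx.1, ?_⟩
      have := hx.2
      have hij' : (i : ℕ) ≠ j := fun h => hij (Fin.ext h)
      simp only [simpleGen, swap_apply_def, Fin.ext_iff] at this
      split_ifs at this <;> simp_all <;> omega

/-- If `w` is spherical, some point of `{0, …, k}` stays in `{0, …, k}`, or `1, …, k + 1` occur in
decreasing order in `w`. -/
theorem IsSpherical.exists_or_forall {n k : ℕ} (hn : k + 2 ≤ n) {w : Perm (Fin n)}
    (hw : IsSpherical w) :
    (∃ x y : Fin (k + 1), w (x.castLE (by omega)) = y.castLE (by omega)) ∨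
      ∀ i : Fin (k + 1), w⁻¹ ⟨k + 1, by omega⟩ ≤ w⁻¹ ⟨i + 1, by omega⟩ := by
  -- The index `0` is left out because only one point lies below its cut, and one crossing is
  -- allowed.
  by_cases h : ∀ j : Fin (n - 1), 1 ≤ (j : ℕ) → (j : ℕ) ≤ k → j ∈ leftDescents w
  · right
    have key : ∀ d i : ℕ, (hd : i + d = k) →
        w⁻¹ ⟨k + 1, by omega⟩ ≤ w⁻¹ ⟨i + 1, by omega⟩ := by
      intro d
      induction d with
      | zero => intro i hi; obtain rfl : i = k := hi; exact le_rfl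
      | succ d ih =>
        intro i hi
        exact (ih (i + 1) (by omega)).trans
          (inv_lt_inv_of_mem_leftDescents (h ⟨i + 1, by omega⟩ (by simp) (by simp; omega))).le
    intro i
    exact key (k - i) i (by omega)
  · left
    push Not at h
    obtain ⟨j, h1, h2, h3⟩ := h
    obtain ⟨l, ⟨rfl, -⟩, hl, -⟩ := hw
    by_contra hne
    push Not at hne
    have hcross : ∀ x : Fin n, (x : ℕ) ≤ j → (j : ℕ) < wordProd l x := by
      intro x hx
      by_contra hlt
      exact hne ⟨x, by omega⟩ ⟨wordProd l x, by omega⟩ (by ext; rfl)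
    have hcard := (card_crossing_le_count j l).trans (hl j h3)
    rw [Finset.card_le_one] at hcard
    have := hcard ⟨0, by omega⟩ (by simpa using hcross ⟨0, by omega⟩ (by simp))
      ⟨1, by omega⟩ (by simpa using ⟨h1, hcross ⟨1, by omega⟩ (by simpa using h1)⟩)
    simp at this

/-- The translates `g i * F` are pairwise disjoint, since `f u` holds for at most one index. -/
theorem card_mul_card_le {G ι : Type*} [Group G] [Fintype G] [Fintype ι] (F : Finset G)
    (g : ι → G) (f : G → ι → Prop) (hf : ∀ u i i', f u i → f u i' → i = i')
    (h : ∀ w ∈ F, ∀ i, f (g i * w) i) : Fintype.card ι * F.card ≤ Fintype.card G := by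
  classical
  rw [← Finset.card_univ (α := ι), ← Finset.card_univ (α := G), ← Finset.card_product]
  refine Finset.card_le_card_of_injOn (fun p => g p.1 * p.2) (fun _ _ => Finset.mem_univ _) ?_
  rintro ⟨i, w⟩ hi ⟨i', w'⟩ hi' he
  simp only [Finset.coe_product, Set.mem_prod, Finset.mem_coe] at hi hi' he
  obtain rfl := hf _ _ _ (h w hi.2 i) (he ▸ h w' hi'.2 i')
  simpa using he

theorem card_filter_apply_eq {n : ℕ} (x y : Fin n) :
    n * (Finset.univ.filter fun w : Perm (Fin n) => w x = y).card ≤ n.factorial := by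
  have := card_mul_card_le (Finset.univ.filter fun w : Perm (Fin n) => w x = y)
    (fun z => swap y z) (fun u z => u x = z) (fun u i i' h h' => h.symm.trans h')
    (by intro w hw i; simp [(Finset.mem_filter.1 hw).2])
  simpa [Fintype.card_perm] using this

theorem card_filter_inv_le {n k : ℕ} (hn : k + 2 ≤ n) :
    (k + 1) * (Finset.univ.filter fun w : Perm (Fin n) =>
      ∀ i : Fin (k + 1), w⁻¹ ⟨k + 1, by omega⟩ ≤ w⁻¹ ⟨i + 1, by omega⟩).card ≤ n.factorial := by
  let e : Fin (k + 1) → Fin n := fun i => ⟨i + 1, by omega⟩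
  have he : Function.Injective e := fun i i' h => by simpa [e, Fin.ext_iff] using h
  have := card_mul_card_le (Finset.univ.filter fun w : Perm (Fin n) =>
      ∀ i : Fin (k + 1), w⁻¹ (e (Fin.last k)) ≤ w⁻¹ (e i))
    -- The swap moves the minimum of the inverse from `k + 1` to `e i`, so the translate determines
    -- `i`.
    (fun i => swap (e i) (e (Fin.last k)))
    (fun u i => ∀ i', u⁻¹ (e i) ≤ u⁻¹ (e i'))
    (fun u i i' h h' => he (u⁻¹.injective (le_antisymm (h i') (h' i)))) (by
      intro w hw i i'
      have hw := (Finset.mem_filter.1 hw).2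
      simp only [mul_inv_rev, swap_inv, Perm.mul_apply, swap_apply_left]
      rcases eq_or_ne i' i with rfl | h1
      · simp
      rcases eq_or_ne i' (Fin.last k) with rfl | h2
      · simpa using hw i
      · rw [swap_apply_of_ne_of_ne (he.ne h1) (he.ne h2)]
        exact hw i')
  simpa [Fintype.card_perm, e] using this

theorem card_isSpherical_div_le {n k : ℕ} (hn : k + 2 ≤ n) :
    (Nat.card {w : Perm (Fin n) // IsSpherical w} : ℝ) / n.factorial ≤
      (k + 1 : ℝ) ^ 2 / n + 1 / (k + 1 : ℝ) := by
  classical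
  let A : Fin (k + 1) × Fin (k + 1) → Finset (Perm (Fin n)) := fun p =>
    Finset.univ.filter fun w => w (p.1.castLE (by omega)) = p.2.castLE (by omega)
  let B : Finset (Perm (Fin n)) := Finset.univ.filter fun w =>
    ∀ i : Fin (k + 1), w⁻¹ ⟨k + 1, by omega⟩ ≤ w⁻¹ ⟨i + 1, by omega⟩
  have hn0 : (0 : ℝ) < n := by exact_mod_cast (by omega : 0 < n)
  have hA : ∀ p, ((A p).card : ℝ) ≤ n.factorial / n := fun p => by
    rw [le_div_iff₀ hn0, mul_comm]
    exact_mod_cast card_filter_apply_eq _ _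
  have hB : (B.card : ℝ) ≤ n.factorial / (k + 1) := by
    rw [le_div_iff₀ (by positivity), mul_comm]
    exact_mod_cast card_filter_inv_le hn
  have hsub : (Finset.univ.filter fun w : Perm (Fin n) => IsSpherical w) ⊆
      Finset.univ.biUnion A ∪ B := by
    intro w hw
    rcases (Finset.mem_filter.1 hw).2.exists_or_forall hn with ⟨x, y, hxy⟩ | h
    · exact Finset.mem_union_left _
        (Finset.mem_biUnion.2 ⟨(x, y), Finset.mem_univ _, by simpa [A] using hxy⟩)
    · exact Finset.mem_union_right _ (by simpa [B] using h)
  have hcard : ((Finset.univ.filter fun w : Perm (Fin n) => IsSpherical w).card : ℝ) ≤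
      ∑ p, ((A p).card : ℝ) + B.card := by
    exact_mod_cast (Finset.card_le_card hsub).trans
      ((Finset.card_union_le _ _).trans (Nat.add_le_add_right Finset.card_biUnion_le _))
  have hsum : ∑ p, ((A p).card : ℝ) ≤ (k + 1 : ℝ) ^ 2 * (n.factorial / n) := by
    refine (Finset.sum_le_sum fun p _ => hA p).trans (le_of_eq ?_)
    simp [sq]
  have hf : (0 : ℝ) < n.factorial := by exact_mod_cast n.factorial_pos
  rw [Nat.card_eq_fintype_card, Fintype.card_subtype, div_le_iff₀ hf]
  calc _ ≤ _ := hcard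
    _ ≤ (k + 1 : ℝ) ^ 2 * (n.factorial / n) + n.factorial / (k + 1) := add_le_add hsum hB
    _ = _ := by ring

end SphericalPerm

theorem corollary1p5 :
    Filter.Tendsto
      (fun n : ℕ =>
        (Nat.card {w : Equiv.Perm (Fin n) // SphericalPerm.IsSpherical w} : ℝ) /
          (Nat.factorial n : ℝ))
      Filter.atTop (nhds 0) := by
  rw [Metric.tendsto_atTop]
  intro ε hε
  -- `k` is fixed before `n`, so that `(k + 1)^2 / n` still tends to zero.
  obtain ⟨k, hk⟩ := exists_nat_one_div_lt (half_pos hε)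
  have hlim := (tendsto_const_div_atTop_nhds_zero_nat ((k + 1 : ℝ) ^ 2)).eventually
    (gt_mem_nhds (half_pos hε))
  obtain ⟨N, hN⟩ := Filter.eventually_atTop.1 hlim
  refine ⟨max N (k + 2), fun n hn => ?_⟩
  have h1 := hN n ((le_max_left _ _).trans hn)
  have h2 := SphericalPerm.card_isSpherical_div_le ((le_max_right N (k + 2)).trans hn)
  rw [Real.dist_eq, sub_zero, abs_of_nonneg (by positivity)]
  linarith
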